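/- **Setting.** Let $S\subset\mathbb R^d$ be nonempty and closed, and let $\text{usc-fcns}(S)$ be the set of upper semicontinuous $f:S\to[-\infty,\infty]$ with $f\not\equiv-\infty$. Write $\operatorname{hypo} f=\{(x,\alpha)\in S\times\mathbb R: f(x)\ge\alpha\}$. Fix a norm $\|\cdot\|$ on $\mathbb R^d\times\mathbb R$ and a point $\bar x^{\rm cent}$. Equip $\text{usc-fcns}(S)$ with the aw-distance $$\mathbb d(f,g)=\int_0^\infty \max_{\|\bar x-\bar x^{\rm cent}\|\le\rho}\bigl|\operatorname{dist}(\bar x,\operatorname{hypo} f)-\operatorname{dist}(\bar x,\operatorname{hypo} g)\bigr|\,e^{-\rho}\,d\rho ,$$ which is a metric. For sets $A^n$ in a metric space, $\operatorname{OutLim}A^n$ is the set of limits of convergent sequences $a^k\in A^{n_k}$ with $n_1<n_2<\cdots$; $\operatorname{InnLim}A^n$ is the set of limits of convergent sequences with $a^n\in A^n$ for all large $n$; and $\operatorname{Lim}A^n=A$ means that both equal $A$. For $\varepsilon\ge0$ put $\varepsilon\text{-}\operatorname{argmin}_{f\in C}\varphi(f)=\{f\in C:\varphi(f)\le\inf_{g\in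 C}\varphi(g)+\varepsilon\}$, and $\operatorname{argmin}=0\text{-}\operatorname{argmin}$. In $[-\infty,\infty]$, $-\infty+\infty=\infty$ and $\inf\emptyset=\infty$. **Theorem (consistency; sieves).** Let $S^0\subset\mathbb R^{d_0}$ carry a complete probability space $(S^0,\mathcal B,P^0)$, and let $X^1,X^2,\dots$ be iid with values in $S^0$ and distribution $P^0$. Let $F\subset\text{usc-fcns}(S)$ be closed and let $F^n\subset F$, $n\in\mathbb N$, be such that $\operatorname{Lim}F^n$ exists. Let $\psi:S^0\times F\to[-\infty,\infty]$ be a locally inf-integrable random lsc function, that is: * $\psi$ is measurable for the product of $\mathcal B$ and the Borel $\sigma$-algebra of $(F,\mathbb d)$; * $\psi(x,\cdot)$ is lower semicontinuous for every $x\in S^0$; * for every $f\in F$ there is $\rho>0$ such that the negative part of $x\mapsto\inf\{\psi(x,g): g\in F,\ \mathbb d(f,g)\le\rho\}$ has a finite $P^0$-integral. Let $\pi^n:F\to[0,\infty)$ satisfy $\pi^n(f^n)\to0$ for every sequence $f^n\in F$ that converges in $F$. Let $\delta>0$ and let $\varepsilon^n\ge0$ with $\varepsilon^n\to0$. Put $$F^n_\delta=\Bigl\{f\in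 F:\inf_{g\in F^n}\mathbb d(f,g)\le\delta\Bigr\},\qquad F^\infty_\delta=\Bigl\{f\in F:\inf_{g\in\operatorname{Lim}F^n}\mathbb d(f,g)\le\delta\Bigr\}.$$ Then, almost surely, $$\operatorname{OutLim}\Bigl(\varepsilon^n\text{-}\operatorname*{argmin}_{f\in F^n_\delta}\ \frac1n\sum_{j=1}^n\psi(X^j,f)+\pi^n(f)\Bigr)\subset\Bigl\{f\in F^\infty_\delta:\ \mathbb E[\psi(X^1,f)]\le\inf_{g\in\operatorname{Lim}F^n}\mathbb E[\psi(X^1,g)]\Bigr\}.$$ In particular, if $\operatorname{Lim}F^n=F$, then the right-hand side equals $\operatorname{argmin}_{f\in F}\mathbb E[\psi(X^1,f)]$. -/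

import Mathlib

open MeasureTheory ProbabilityTheory Filter Topology

noncomputable section

/-- The data on which the numerical value of the aw-distance depends: a norm on `ℝᵈ × ℝ`
(a seminorm that vanishes only at `0`) and a centre. -/
structure AWFrame (d : ℕ) where
  norm : Seminorm ℝ (EuclideanSpace ℝ (Fin d) × ℝ)
  definite : ∀ z, norm z = 0 → z = 0
  center : EuclideanSpace ℝ (Fin d) × ℝ

/-- `dist(z, C) = inf_{a ∈ C} ‖z - a‖` in the norm of the frame (used for nonempty `C`). -/
def AWFrame.distTo {d : ℕ} (A : AWFrame d) (z : EuclideanSpace ℝ (Fin d) × ℝ)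
    (C : Set (EuclideanSpace ℝ (Fin d) × ℝ)) : ℝ :=
  ⨅ a : C, A.norm (z - a)

/-- `usc-fcns(S)`: the usc functions `f : S → [-∞, ∞]` with `f ≢ -∞`. The frame `A` is recorded
in the type only because the metric that this type carries (the aw-distance) depends on it. -/
@[ext]
structure UscFcn {d : ℕ} (S : Set (EuclideanSpace ℝ (Fin d))) (A : AWFrame d) where
  toFun : S → EReal
  usc : UpperSemicontinuous toFun
  ne_bot : ∃ x, toFun x ≠ ⊥

namespace UscFcn

variable {d : ℕ} {S : Set (EuclideanSpace ℝ (Fin d))} {A : AWFrame d}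

/-- The hypograph `{(x, α) ∈ S × ℝ | α ≤ f x}`, as a subset of `ℝᵈ × ℝ`. -/
def hypo (f : UscFcn S A) : Set (EuclideanSpace ℝ (Fin d) × ℝ) :=
  {z | ∃ h : z.1 ∈ S, (z.2 : EReal) ≤ f.toFun ⟨z.1, h⟩}

/-- The `ρ`-aw-distance: the largest difference of the distance functions to the two hypographs
over the ball of radius `ρ` about the centre. -/
def awDistAt (ρ : ℝ) (f g : UscFcn S A) : ℝ :=
  ⨆ z : {z // A.norm (z - A.center) ≤ ρ}, |A.distTo z f.hypo - A.distTo z g.hypo|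

/-- The aw-distance `∫₀^∞ d_ρ(f, g) e^{-ρ} dρ`. -/
def awDist (f g : UscFcn S A) : ℝ :=
  ∫ ρ in Set.Ioi (0 : ℝ), awDistAt ρ f g * Real.exp (-ρ)

end UscFcn

/-! ### The aw-distance is a metric -/

theorem AWFrame.bddBelow_distTo {d : ℕ} (A : AWFrame d) (z : EuclideanSpace ℝ (Fin d) × ℝ)
    (C : Set (EuclideanSpace ℝ (Fin d) × ℝ)) :
    BddBelow (Set.range fun a : C => A.norm (z - a)) :=
  ⟨0, by rintro _ ⟨a, rfl⟩; exact apply_nonneg _ _⟩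

theorem AWFrame.distTo_le_add {d : ℕ} (A : AWFrame d) (z w : EuclideanSpace ℝ (Fin d) × ℝ)
    {C : Set (EuclideanSpace ℝ (Fin d) × ℝ)} (hC : C.Nonempty) :
    A.distTo z C ≤ A.distTo w C + A.norm (z - w) := by
  have : Nonempty C := hC.to_subtype
  rw [← sub_le_iff_le_add]
  refine le_ciInf fun a => ?_
  rw [sub_le_iff_le_add]
  refine (ciInf_le (A.bddBelow_distTo z C) a).trans ?_
  have h := map_add_le_add A.norm (w - a) (z - w)
  have e : (w - (a : EuclideanSpace ℝ (Fin d) × ℝ)) + (z - w) = z - a := by abel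
  rwa [e] at h

theorem AWFrame.exists_norm_le {d : ℕ} (A : AWFrame d) :
    ∃ c : ℝ, 0 < c ∧ ∀ z, ‖z‖ ≤ c * A.norm z := by
  have hcont : Continuous A.norm := by
    have h := (A.norm.convexOn).continuousOn isOpen_univ
    exact continuousOn_univ.1 h
  by_cases hne : (Metric.sphere (0 : EuclideanSpace ℝ (Fin d) × ℝ) 1).Nonempty
  · obtain ⟨u, hu, hmin⟩ := (isCompact_sphere _ _).exists_isMinOn hne hcont.continuousOn
    have hu1 : ‖u‖ = 1 := by simpa using hu
    have hpos : 0 < A.norm u := by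
      refine lt_of_le_of_ne (apply_nonneg _ _) fun h => ?_
      have := A.definite u h.symm
      rw [this] at hu1
      simp at hu1
    refine ⟨(A.norm u)⁻¹, inv_pos.2 hpos, fun z => ?_⟩
    by_cases hz : z = 0
    · simp [hz]
    have hz' : 0 < ‖z‖ := norm_pos_iff.2 hz
    have hs : (‖z‖⁻¹ • z) ∈ Metric.sphere (0 : EuclideanSpace ℝ (Fin d) × ℝ) 1 := by
      rw [mem_sphere_zero_iff_norm, norm_smul, norm_inv, norm_norm, inv_mul_cancel₀ hz'.ne']
    have h := hmin hs
    simp only [Set.mem_ofPred_eq, map_smul_eq_mul, norm_inv, norm_norm] at h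
    rw [inv_mul_eq_div, le_div_iff₀ hz'] at h
    rw [inv_mul_eq_div, le_div_iff₀ hpos]
    linarith
  · refine ⟨1, one_pos, fun z => ?_⟩
    by_cases hz : z = 0
    · simp [hz]
    have hz' : 0 < ‖z‖ := norm_pos_iff.2 hz
    exact absurd ⟨‖z‖⁻¹ • z, by
      rw [mem_sphere_zero_iff_norm, norm_smul, norm_inv, norm_norm, inv_mul_cancel₀ hz'.ne']⟩ hne

theorem AWFrame.mem_closure_of_distTo_le {d : ℕ} (A : AWFrame d)
    {z : EuclideanSpace ℝ (Fin d) × ℝ} {C : Set (EuclideanSpace ℝ (Fin d) × ℝ)}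
    (hC : C.Nonempty) (h : A.distTo z C ≤ 0) : z ∈ closure C := by
  have : Nonempty C := hC.to_subtype
  obtain ⟨c, hc, hle⟩ := A.exists_norm_le
  rw [Metric.mem_closure_iff]
  intro e he
  obtain ⟨a, ha⟩ := exists_lt_of_ciInf_lt (lt_of_le_of_lt h (div_pos he hc))
  refine ⟨a, a.2, ?_⟩
  rw [dist_eq_norm]
  refine (hle _).trans_lt ?_
  rw [lt_div_iff₀ hc] at ha
  linarith

theorem AWFrame.distTo_eq_zero_of_mem {d : ℕ} (A : AWFrame d)
    {z : EuclideanSpace ℝ (Fin d) × ℝ} {C : Set (EuclideanSpace ℝ (Fin d) × ℝ)}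
    (h : z ∈ C) : A.distTo z C = 0 := by
  have : Nonempty C := ⟨⟨z, h⟩⟩
  refine le_antisymm ?_ (le_ciInf fun a => apply_nonneg _ _)
  refine (ciInf_le (A.bddBelow_distTo z C) ⟨z, h⟩).trans ?_
  simp

namespace UscFcn

variable {d : ℕ} {S : Set (EuclideanSpace ℝ (Fin d))} {A : AWFrame d}

theorem hypo_nonempty (f : UscFcn S A) : f.hypo.Nonempty := by
  obtain ⟨x, hx⟩ := f.ne_bot
  obtain ⟨r, hr⟩ := EReal.lt_iff_exists_real_btwn.1 (bot_lt_iff_ne_bot.2 hx)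
  exact ⟨(x, r), x.2, hr.2.le⟩

theorem mem_hypo_of_mem_closure {f : UscFcn S A} {z : EuclideanSpace ℝ (Fin d) × ℝ}
    (hz : z ∈ closure f.hypo) (hS : z.1 ∈ S) : z ∈ f.hypo := by
  refine ⟨hS, ?_⟩
  by_contra hlt
  rw [not_le] at hlt
  obtain ⟨r, hr1, hr2⟩ := EReal.lt_iff_exists_real_btwn.1 hlt
  have hev := f.usc ⟨z.1, hS⟩ (r : EReal) hr1
  rw [nhds_subtype, eventually_comap] at hev
  have h1 : ∀ᶠ w in 𝓝 z, ∀ a : S, (a : EuclideanSpace ℝ (Fin d)) = w.1 → f.toFun a < r :=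
    (continuous_fst.tendsto z).eventually hev
  have h2 : ∀ᶠ w in 𝓝 z, r < w.2 :=
    (continuous_snd.tendsto z).eventually (lt_mem_nhds (EReal.coe_lt_coe_iff.1 hr2))
  obtain ⟨w, ⟨hw1, hw2⟩, hwS, hw⟩ := (mem_closure_iff_nhds.1 hz _ (h1.and h2))
  have h3 := hw1 ⟨w.1, hwS⟩ rfl
  exact absurd (h3.trans (EReal.coe_lt_coe_iff.2 hw2)) (not_lt.2 hw)

theorem eq_of_hypo_eq {f g : UscFcn S A} (h : f.hypo = g.hypo) : f = g := by
  have key : ∀ {f g : UscFcn S A}, f.hypo = g.hypo → ∀ x, f.toFun x ≤ g.toFun x := by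
    intro f g h x
    by_contra hlt
    rw [not_le] at hlt
    obtain ⟨r, hr1, hr2⟩ := EReal.lt_iff_exists_real_btwn.1 hlt
    have hm : ((x : EuclideanSpace ℝ (Fin d)), r) ∈ f.hypo := ⟨x.2, hr2.le⟩
    rw [h] at hm
    obtain ⟨_, hm⟩ := hm
    exact absurd hr1 (not_lt.2 hm)
  ext x
  exact le_antisymm (key h x) (key h.symm x)

theorem abs_diff_le (f g : UscFcn S A) (z w : EuclideanSpace ℝ (Fin d) × ℝ) :
    |A.distTo z f.hypo - A.distTo z g.hypo|
      ≤ |A.distTo w f.hypo - A.distTo w g.hypo| + 2 * A.norm (z - w) := by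
  have hs : A.norm (w - z) = A.norm (z - w) := map_sub_rev _ _ _
  have f1 := A.distTo_le_add z w f.hypo_nonempty
  have f2 := A.distTo_le_add w z f.hypo_nonempty
  have g1 := A.distTo_le_add z w g.hypo_nonempty
  have g2 := A.distTo_le_add w z g.hypo_nonempty
  rw [hs] at f2 g2
  have h1 := le_abs_self (A.distTo w f.hypo - A.distTo w g.hypo)
  have h2 := neg_abs_le (A.distTo w f.hypo - A.distTo w g.hypo)
  rw [abs_le]
  constructor <;> linarith

theorem bddAbove_awDistAt (ρ : ℝ) (f g : UscFcn S A) :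
    BddAbove (Set.range fun z : {z // A.norm (z - A.center) ≤ ρ} =>
      |A.distTo z f.hypo - A.distTo z g.hypo|) := by
  refine ⟨|A.distTo A.center f.hypo - A.distTo A.center g.hypo| + 2 * ρ, ?_⟩
  rintro _ ⟨z, rfl⟩
  refine (abs_diff_le f g z A.center).trans ?_
  have := z.2
  linarith

theorem awDistAt_nonneg (ρ : ℝ) (f g : UscFcn S A) : 0 ≤ awDistAt ρ f g :=
  Real.iSup_nonneg fun _ => abs_nonneg _

theorem le_awDistAt {ρ : ℝ} (f g : UscFcn S A) {z : EuclideanSpace ℝ (Fin d) × ℝ}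
    (hz : A.norm (z - A.center) ≤ ρ) :
    |A.distTo z f.hypo - A.distTo z g.hypo| ≤ awDistAt ρ f g :=
  le_ciSup (bddAbove_awDistAt ρ f g) (⟨z, hz⟩ : {z // A.norm (z - A.center) ≤ ρ})

theorem awDistAt_le {ρ : ℝ} (hρ : 0 ≤ ρ) (f g : UscFcn S A) :
    awDistAt ρ f g ≤ |A.distTo A.center f.hypo - A.distTo A.center g.hypo| + 2 * ρ := by
  have : Nonempty {z // A.norm (z - A.center) ≤ ρ} := ⟨⟨A.center, by simpa using hρ⟩⟩
  refine ciSup_le fun z => (abs_diff_le f g z A.center).trans ?_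
  have := z.2
  linarith

theorem awDistAt_mono (f g : UscFcn S A) : Monotone fun ρ => awDistAt ρ f g := by
  intro ρ σ h
  exact Real.iSup_le (fun z => le_awDistAt f g (z.2.trans h)) (awDistAt_nonneg _ _ _)

theorem integrableOn_awDistAt (f g : UscFcn S A) :
    IntegrableOn (fun ρ => awDistAt ρ f g * Real.exp (-ρ)) (Set.Ioi 0) := by
  set K := |A.distTo A.center f.hypo - A.distTo A.center g.hypo| with hK
  have h0 : IntegrableOn (fun ρ : ℝ => Real.exp (-ρ)) (Set.Ioi 0) :=
    integrableOn_exp_neg_Ioi 0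
  have h1 : IntegrableOn (fun ρ : ℝ => Real.exp (-ρ) * ρ) (Set.Ioi 0) := by
    have := Real.GammaIntegral_convergent (s := 2) (by norm_num)
    refine this.congr_fun (fun x _ => ?_) measurableSet_Ioi
    norm_num
  have hdom : IntegrableOn (fun ρ : ℝ => K * Real.exp (-ρ) + 2 * (Real.exp (-ρ) * ρ))
      (Set.Ioi 0) := (h0.const_mul K).add (h1.const_mul 2)
  refine hdom.mono' ?_ ?_
  · exact ((awDistAt_mono f g).measurable.mul (by fun_prop)).aestronglyMeasurable
  · filter_upwards [ae_restrict_mem measurableSet_Ioi] with ρ hρ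
    have hρ : 0 < ρ := hρ
    rw [Real.norm_of_nonneg (mul_nonneg (awDistAt_nonneg _ _ _) (Real.exp_pos _).le)]
    have h := mul_le_mul_of_nonneg_right (awDistAt_le hρ.le f g) (Real.exp_pos (-ρ)).le
    rw [← hK] at h
    linarith

theorem awDist_self (f : UscFcn S A) : awDist f f = 0 := by
  simp [awDist, awDistAt]

theorem awDist_comm (f g : UscFcn S A) : awDist f g = awDist g f := by
  simp only [awDist, awDistAt, abs_sub_comm]

theorem awDist_triangle (f g h : UscFcn S A) : awDist f h ≤ awDist f g + awDist g h := by
  rw [awDist, awDist, awDist,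
    ← integral_add (integrableOn_awDistAt f g) (integrableOn_awDistAt g h)]
  refine setIntegral_mono (integrableOn_awDistAt f h)
    ((integrableOn_awDistAt f g).add (integrableOn_awDistAt g h)) fun ρ => ?_
  rw [← add_mul]
  refine mul_le_mul_of_nonneg_right ?_ (Real.exp_pos _).le
  refine Real.iSup_le (fun z => ?_) (add_nonneg (awDistAt_nonneg _ _ _) (awDistAt_nonneg _ _ _))
  exact (abs_sub_le _ (A.distTo z g.hypo) _).trans
    (add_le_add (le_awDistAt f g z.2) (le_awDistAt g h z.2))

theorem distTo_eq_of_awDist_eq_zero {f g : UscFcn S A} (h : awDist f g = 0)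
    (z : EuclideanSpace ℝ (Fin d) × ℝ) : A.distTo z f.hypo = A.distTo z g.hypo := by
  by_contra hne
  have hpos : 0 < |A.distTo z f.hypo - A.distTo z g.hypo| := abs_pos.2 (sub_ne_zero.2 hne)
  have hae := (setIntegral_eq_zero_iff_of_nonneg_ae
    (Eventually.of_forall fun ρ => mul_nonneg (awDistAt_nonneg ρ f g) (Real.exp_pos (-ρ)).le)
    (integrableOn_awDistAt f g)).1 h
  set R := A.norm (z - A.center)
  have hR : 0 ≤ R := apply_nonneg _ _
  have hsub : Set.Ioi R ⊆ Set.Ioi (0 : ℝ) := Set.Ioi_subset_Ioi hR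
  have hae' : ∀ᵐ ρ ∂(volume.restrict (Set.Ioi R)), awDistAt ρ f g * Real.exp (-ρ) = 0 :=
    ae_restrict_of_ae_restrict_of_subset hsub hae
  have hfalse : ∀ᵐ _ρ ∂((volume : Measure ℝ).restrict (Set.Ioi R)), False := by
    filter_upwards [hae', ae_restrict_mem measurableSet_Ioi] with ρ h1 h2
    have h3 : 0 < awDistAt ρ f g := hpos.trans_le (le_awDistAt f g (le_of_lt h2))
    exact (mul_pos h3 (Real.exp_pos _)).ne' h1
  rw [eventually_false_iff_eq_bot, ae_eq_bot, Measure.restrict_eq_zero] at hfalse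
  simp at hfalse

instance : MetricSpace (UscFcn S A) where
  dist := awDist
  dist_self := awDist_self
  dist_comm := awDist_comm
  dist_triangle := awDist_triangle
  eq_of_dist_eq_zero := by
    intro f g h
    have key : ∀ {f g : UscFcn S A},
        (∀ z, A.distTo z f.hypo = A.distTo z g.hypo) → f.hypo ⊆ g.hypo := by
      intro f g h z hz
      refine mem_hypo_of_mem_closure (A.mem_closure_of_distTo_le g.hypo_nonempty ?_) hz.1
      rw [← h z, A.distTo_eq_zero_of_mem hz]
    have hd := distTo_eq_of_awDist_eq_zero h
    exact eq_of_hypo_eq (Set.Subset.antisymm (key hd) (key fun z => (hd z).symm))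

/-- The Borel σ-algebra of the aw-distance. -/
instance : MeasurableSpace (UscFcn S A) := borel _

instance : BorelSpace (UscFcn S A) := ⟨rfl⟩

end UscFcn

/-! ### Limits of sequences of sets -/

/-- The outer limit of a sequence of sets: the limits of sequences of points taken along a
subsequence of the sets. -/
def outerLimit {Y : Type*} [TopologicalSpace Y] (C : ℕ → Set Y) : Set Y :=
  {y | ∃ (k : ℕ → ℕ) (a : ℕ → Y), StrictMono k ∧ (∀ i, a i ∈ C (k i)) ∧ Tendsto a atTop (𝓝 y)}

/-- The inner limit of a sequence of sets: the limits of sequences of points taken from all but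
finitely many of the sets (finitely many sets may be empty). -/
def innerLimit {Y : Type*} [TopologicalSpace Y] (C : ℕ → Set Y) : Set Y :=
  {y | ∃ a : ℕ → Y, (∀ᶠ n in atTop, a n ∈ C n) ∧ Tendsto a atTop (𝓝 y)}

/-- `C n → L`, that is, `Lim C n` exists and equals `L`. -/
def SetConverges {Y : Type*} [TopologicalSpace Y] (C : ℕ → Set Y) (L : Set Y) : Prop :=
  outerLimit C = L ∧ innerLimit C = L

/-! ### Extended-real calculus, near-minimizers, expectations -/

/-- `ε-argmin_{f ∈ C} φ(f) = {f ∈ C | φ f ≤ inf_{g ∈ C} φ g + ε}`. -/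
def epsArgmin {Y : Type*} (ε : ℝ) (C : Set Y) (φ : Y → EReal) : Set Y :=
  {f ∈ C | φ f ≤ (⨅ g ∈ C, φ g) + (ε : EReal)}

open Classical in
/-- `a 0 + ... + a (n - 1)` in `[-∞, ∞]` with the convention `-∞ + ∞ = ∞`
(Mathlib's addition on `EReal` has `⊥ + ⊤ = ⊥`). -/
def extSum (n : ℕ) (a : ℕ → EReal) : EReal :=
  if ∃ j < n, a j = ⊤ then ⊤ else ∑ j ∈ Finset.range n, a j

/-- `E[h] = ∫ h⁺ - ∫ h⁻` in `[-∞, ∞]`, with `∞ - ∞ = ∞`. -/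
def extExpectation {Ω : Type*} [MeasurableSpace Ω] (P : Measure Ω) (h : Ω → EReal) : EReal :=
  if ∫⁻ ω, (h ω).toENNReal ∂P = ⊤ then ⊤
  else ((∫⁻ ω, (h ω).toENNReal ∂P : ENNReal) : EReal)
    - ((∫⁻ ω, (-(h ω)).toENNReal ∂P : ENNReal) : EReal)

/-! ### Samples and losses -/

/-- `X 0, X 1, ...` are independent and all have the distribution `P₀`. Preimages of measurable
sets are only asked to be measurable up to `P`-null sets, so that for a complete `P₀` the space
`(Ω, P)` itself need not be complete: independent Borel random vectors with a common law form
such a sample for the completion of that law. -/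
structure IsIIDSample {Ω Ξ : Type*} [MeasurableSpace Ω] [MeasurableSpace Ξ]
    (X : ℕ → Ω → Ξ) (P : Measure Ω) (P₀ : Measure Ξ) : Prop where
  nullMeasurable : ∀ j, NullMeasurable (X j) P
  law : ∀ j s, MeasurableSet s → P (X j ⁻¹' s) = P₀ s
  indep : iIndepFun X P

/-- Random lsc functions: jointly measurable, and lsc in the second argument. -/
structure IsRandomLsc {Ξ Y : Type*} [MeasurableSpace Ξ] [TopologicalSpace Y] [MeasurableSpace Y]
    (ψ : Ξ → Y → EReal) : Prop where
  lsc : ∀ x, LowerSemicontinuous (ψ x)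
  measurable : Measurable fun p : Ξ × Y => ψ p.1 p.2

/-- Local inf-integrability: for each `f` there is `ρ > 0` such that the integral of
`x ↦ inf {ψ x g | dist f g ≤ ρ}` is greater than `-∞`, that is, the negative part of this
function has a finite integral. -/
def LocallyInfIntegrable {Ξ Y : Type*} [MeasurableSpace Ξ] [PseudoMetricSpace Y]
    (P₀ : Measure Ξ) (ψ : Ξ → Y → EReal) : Prop :=
  ∀ f : Y, ∃ ρ : ℝ, 0 < ρ ∧
    ∫⁻ x, (-(⨅ g ∈ {g : Y | dist f g ≤ ρ}, ψ x g)).toENNReal ∂P₀ < ⊤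

/-- The penalized empirical loss `n⁻¹ ∑_{j < n} ψ(x j, f) + pen f`, for `n ≥ 1`. -/
def empiricalLoss {Ξ Y : Type*} (ψ : Ξ → Y → EReal) (n : ℕ) (x : ℕ → Ξ) (pen : Y → NNReal)
    (f : Y) : EReal :=
  (((n : ℝ)⁻¹ : ℝ) : EReal) * extSum n (fun j => ψ (x j) f) + (((pen f : NNReal) : ℝ) : EReal)

/-- The `δ`-enlargement `{f | inf_{g ∈ C} dist f g ≤ δ}` (empty if `C` is empty). -/
def enlarge {Y : Type*} [PseudoMetricSpace Y] (δ : ℝ) (C : Set Y) : Set Y :=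
  {f | (⨅ g ∈ C, ((dist f g : ℝ) : EReal)) ≤ (δ : EReal)}

end

/-! This is a Wald-type consistency argument, made possible by compactness of closed balls in
`UscFcn S A` (`UscFcn.properSpace`). Along an ultrafilter containing a ball the distance functions
converge pointwise, and the zero set of the limit is the hypograph of the limit function. Hence `F`
is proper, in particular Polish, and measurable projection for the complete measure `P₀` makes `x ↦
⨅ g ∈ U, ψ x g` measurable for Borel `U`.

The strong law for these infima, with `U` in a countable basis, combines with lower semicontinuity
and monotone convergence into a locally uniform lower bound
(`IsIIDSample.ae_forall_exists_nhds_lt_average`): almost surely, near every `f`, the averages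
eventually exceed any number below the expectation at `f`. The strong law at countably many points
of `L` that approach the infimum gives the matching upper bounds.

Suppose a limit `f` of near-minimizers had expectation above the infimum. Some `g ∈ L` then has
expectation below it. Since `δ > 0`, this fixed `g` eventually lies in the enlarged sieves, so it
beats the near-minimizers close to `f`, a contradiction. That `f ∈ enlarge δ L` is again compactness
(`outerLimit_enlarge_subset`). -/

/-! ### Analytic sets are universally measurable, and measurable projections -/

/-- Inner approximation of the image of the Baire space by a compact subset. -/
theorem exists_isCompact_subset_range_of_lt_measure {α : Type*} [MetricSpace α]
    [MeasurableSpace α] [BorelSpace α] (μ : Measure α) [IsFiniteMeasure μ]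
    {f : (ℕ → ℕ) → α} (hf : Continuous f) {c : ENNReal} (hc : c < μ (Set.range f)) :
    ∃ K ⊆ Set.range f, IsCompact K ∧ c ≤ μ K := by
  -- Capping coordinate `n` at a large `k` keeps the measure above `c`: the images increase to `f ''
  -- C`, and continuity from below needs no measurability of the images.
  have step : ∀ (n : ℕ) (C : {C : Set (ℕ → ℕ) // c < μ (f '' C)}),
      ∃ k : ℕ, c < μ (f '' (C.1 ∩ {x | x n ≤ k})) := by
    intro n C
    have hmono : Monotone fun k : ℕ => f '' (C.1 ∩ {x | x n ≤ k}) := fun a b hab =>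
      Set.image_mono fun x hx => ⟨hx.1, le_trans hx.2 hab⟩
    have hU : ⋃ k : ℕ, f '' (C.1 ∩ {x | x n ≤ k}) = f '' C.1 := by
      rw [← Set.image_iUnion, ← Set.inter_iUnion]
      congr 1
      refine Set.inter_eq_left.2 fun x _ => Set.mem_iUnion.2 ⟨x n, le_refl (x n)⟩
    have h := tendsto_measure_iUnion_atTop (μ := μ) hmono
    rw [hU] at h
    exact (h.eventually (lt_mem_nhds C.2)).exists
  choose k hk using step
  let C : ℕ → {C : Set (ℕ → ℕ) // c < μ (f '' C)} := fun n =>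
    Nat.rec ⟨Set.univ, by rwa [Set.image_univ]⟩ (fun n C => ⟨C.1 ∩ {x | x n ≤ k n C}, hk n C⟩) n
  let m : ℕ → ℕ := fun n => k n (C n)
  have hC : ∀ n, (C n).1 = {x | ∀ i < n, x i ≤ m i} := by
    intro n
    induction n with
    | zero => ext x; simp [C]
    | succ n ih =>
      change (C n).1 ∩ {x | x n ≤ m n} = _
      rw [ih]
      ext x
      simp only [Set.mem_inter_iff, Set.mem_ofPred_eq, Nat.lt_succ_iff_lt_or_eq]
      constructor
      · rintro ⟨h1, h2⟩ i (hi | rfl)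
        exacts [h1 i hi, h2]
      · exact fun h => ⟨fun i hi => h i (Or.inl hi), h n (Or.inr rfl)⟩
  set K : Set (ℕ → ℕ) := Set.univ.pi fun i => Set.Iic (m i) with hKdef
  have hK : IsCompact K := isCompact_univ_pi fun i => (Set.finite_Iic (m i)).isCompact
  refine ⟨f '' K, Set.image_subset_range _ _, hK.image hf, ?_⟩
  have hanti : Antitone fun n => closure (f '' (C n).1) := by
    refine antitone_nat_of_succ_le fun n => closure_mono (Set.image_mono ?_)
    exact Set.inter_subset_left
  have hsub : ⋂ n, closure (f '' (C n).1) ⊆ f '' K := by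
    intro y hy
    have hx : ∀ n : ℕ, ∃ x ∈ (C n).1, dist y (f x) < 1 / ((n : ℝ) + 1) := by
      intro n
      obtain ⟨_, ⟨x, hx, rfl⟩, h⟩ :=
        Metric.mem_closure_iff.1 (Set.mem_iInter.1 hy n) _ (Nat.one_div_pos_of_nat (n := n))
      exact ⟨x, hx, h⟩
    choose x hxC hxd using hx
    -- Truncation by `m` moves `x n` into the compact `K` but leaves its coordinates `i < n`
    -- unchanged, so the truncated and the original points have the same limit.
    obtain ⟨z, hzK, φ, hφ, hz⟩ := hK.tendsto_subseq (x := fun n i => min (x n i) (m i))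
      fun n i _ => min_le_right (x n i) (m i)
    have hxz : Tendsto (fun n => x (φ n)) atTop (𝓝 z) := by
      rw [tendsto_pi_nhds] at hz ⊢
      intro i
      refine (hz i).congr' ?_
      filter_upwards [hφ.tendsto_atTop.eventually_gt_atTop i] with n hn
      have h := hxC (φ n)
      rw [hC] at h
      exact min_eq_left (h i hn)
    have h1 := (hf.tendsto z).comp hxz
    have h2 : Tendsto (fun n => f (x (φ n))) atTop (𝓝 y) := by
      have : Tendsto (fun n => f (x n)) atTop (𝓝 y) := by
        rw [tendsto_iff_dist_tendsto_zero]
        refine squeeze_zero (fun _ => dist_nonneg) (fun n => ?_)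
          tendsto_one_div_add_atTop_nhds_zero_nat
        rw [dist_comm]
        exact (hxd n).le
      exact this.comp hφ.tendsto_atTop
    exact ⟨z, hzK, tendsto_nhds_unique h1 h2⟩
  have hlim := tendsto_measure_iInter_atTop (μ := μ)
    (fun n => (isClosed_closure (s := f '' (C n).1)).measurableSet.nullMeasurableSet) hanti
    ⟨0, measure_ne_top _ _⟩
  refine (ge_of_tendsto' hlim fun n => ?_).trans (measure_mono hsub)
  exact ((C n).2.trans_le (measure_mono subset_closure)).le

/-- Analytic sets are universally measurable. -/
theorem MeasureTheory.AnalyticSet.nullMeasurableSet {α : Type*} [MetricSpace α]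
    [MeasurableSpace α] [BorelSpace α] (μ : Measure α) [IsFiniteMeasure μ]
    {s : Set α} (hs : AnalyticSet s) : NullMeasurableSet s μ := by
  have h := hs
  rw [AnalyticSet] at h
  rcases h with rfl | ⟨f, hf, rfl⟩
  · exact MeasurableSet.empty.nullMeasurableSet
  by_cases h0 : μ (Set.range f) = 0
  · exact NullMeasurableSet.of_null h0
  obtain ⟨u, -, hu, hlim⟩ := exists_seq_strictMono_tendsto' (pos_iff_ne_zero.2 h0)
  choose K hKsub hK huK using fun n =>
    exists_isCompact_subset_range_of_lt_measure μ hf (hu n).2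
  have hT : MeasurableSet (⋃ n, K n) := MeasurableSet.iUnion fun n => (hK n).measurableSet
  have hTsub : ⋃ n, K n ⊆ Set.range f := Set.iUnion_subset hKsub
  have hle : μ (Set.range f) ≤ μ (⋃ n, K n) :=
    le_of_tendsto' hlim fun n => (huK n).trans (measure_mono (Set.subset_iUnion K n))
  exact hT.nullMeasurableSet.congr
    (ae_eq_of_subset_of_measure_ge hTsub hle hT.nullMeasurableSet (measure_ne_top _ _))

/-- A measurable set of a product depends on countably many measurable sets of the first factor. -/
theorem MeasurableSet.exists_countable_fst {Ξ Y : Type*} [MeasurableSpace Ξ] [MeasurableSpace Y]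
    {E : Set (Ξ × Y)} (hE : MeasurableSet E) :
    ∃ φ : Ξ → ℕ → ℕ, Measurable φ ∧
      ∃ E' : Set ((ℕ → ℕ) × Y), MeasurableSet E' ∧ E = Prod.map φ id ⁻¹' E' := by
  classical
  induction E, hE using MeasurableSpace.induction_on_inter generateFrom_prod.symm
    isPiSystem_prod with
  | empty => exact ⟨fun _ _ => 0, measurable_const, ∅, MeasurableSet.empty, by simp⟩
  | basic E hE =>
    obtain ⟨s, hs, t, ht, rfl⟩ := hE
    refine ⟨fun x _ => s.indicator 1 x, measurable_pi_lambda _ fun _ => ?_,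
      {b | b 0 ∈ ({1} : Set ℕ)} ×ˢ t, ?_, ?_⟩
    · exact measurable_one.indicator hs
    · exact ((measurable_pi_apply 0) (measurableSet_singleton 1)).prod ht
    · ext ⟨x, y⟩
      simp [Set.indicator_apply]
  | compl E _ ih =>
    obtain ⟨φ, hφ, E', hE', rfl⟩ := ih
    exact ⟨φ, hφ, E'ᶜ, hE'.compl, rfl⟩
  | iUnion E _ _ ih =>
    choose φ hφ E' hE' he using ih
    -- The pairing `ℕ × ℕ ≃ ℕ` merges countably many codes into one, from which each can be read off
    -- again.
    refine ⟨fun x k => φ k.unpair.1 x k.unpair.2, ?_,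
      ⋃ n, Prod.map (fun (b : ℕ → ℕ) m => b (Nat.pair n m)) id ⁻¹' E' n, ?_, ?_⟩
    · exact measurable_pi_lambda _ fun k => (measurable_pi_apply _).comp (hφ _)
    · refine MeasurableSet.iUnion fun n => Measurable.prodMap ?_ measurable_id (hE' n)
      exact measurable_pi_lambda _ fun m => measurable_pi_apply _
    · rw [Set.preimage_iUnion]
      refine Set.iUnion_congr fun n => (he n).trans ?_
      ext ⟨x, y⟩
      simp

/-- Measurable projection, for a complete finite measure and a Polish second factor. -/
theorem MeasurableSet.image_fst_of_isComplete {Ξ Y : Type*} [MeasurableSpace Ξ]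
    (μ : Measure Ξ) [IsFiniteMeasure μ] [μ.IsComplete]
    [TopologicalSpace Y] [PolishSpace Y] [MeasurableSpace Y] [BorelSpace Y]
    {E : Set (Ξ × Y)} (hE : MeasurableSet E) : MeasurableSet (Prod.fst '' E) := by
  obtain ⟨φ, hφ, E', hE', rfl⟩ := hE.exists_countable_fst
  have hA : AnalyticSet (Prod.fst '' E') := hE'.analyticSet.image_of_continuous continuous_fst
  have he : Prod.fst '' (Prod.map φ id ⁻¹' E') = φ ⁻¹' (Prod.fst '' E') := by
    ext x
    constructor
    · rintro ⟨⟨x, y⟩, h, rfl⟩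
      exact ⟨_, h, rfl⟩
    · rintro ⟨⟨b, y⟩, h, rfl⟩
      exact ⟨(x, y), h, rfl⟩
  rw [he]
  let _ := TopologicalSpace.metrizableSpaceMetric (ℕ → ℕ)
  -- The projection is the `φ`-preimage of an analytic set, which is null-measurable for the law of
  -- `φ`; completeness of `μ` removes the null set.
  exact ((hA.nullMeasurableSet (μ.map φ)).preimage
    (hφ.quasiMeasurePreserving μ)).measurable_of_complete

/-! ### Closed balls for the aw-distance are compact -/

theorem AWFrame.continuous_norm {d : ℕ} (A : AWFrame d) : Continuous A.norm :=
  continuousOn_univ.1 ((A.norm.convexOn).continuousOn isOpen_univ)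

theorem AWFrame.isCompact_closedBall {d : ℕ} (A : AWFrame d) (z : EuclideanSpace ℝ (Fin d) × ℝ)
    (r : ℝ) : IsCompact {w | A.norm (w - z) ≤ r} := by
  obtain ⟨c, hc, hle⟩ := A.exists_norm_le
  refine (ProperSpace.isCompact_closedBall z (c * r)).of_isClosed_subset ?_ fun w hw => ?_
  · exact isClosed_le (A.continuous_norm.comp (continuous_id.sub continuous_const))
      continuous_const
  · rw [Metric.mem_closedBall, dist_eq_norm]
    exact (hle _).trans (mul_le_mul_of_nonneg_left hw hc.le)

namespace UscFcn

variable {d : ℕ} {S : Set (EuclideanSpace ℝ (Fin d))} {A : AWFrame d}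

/-- The centre lies in every ball and `e^{-ρ}` has integral one. Thus an aw-bounded family has
hypographs at bounded distance from the centre. -/
theorem abs_distTo_center_le_awDist (f g : UscFcn S A) :
    |A.distTo A.center f.hypo - A.distTo A.center g.hypo| ≤ awDist f g := by
  set K := |A.distTo A.center f.hypo - A.distTo A.center g.hypo|
  have h0 : IntegrableOn (fun ρ : ℝ => K * Real.exp (-ρ)) (Set.Ioi 0) :=
    (integrableOn_exp_neg_Ioi 0).const_mul K
  have h1 : ∫ ρ in Set.Ioi (0 : ℝ), K * Real.exp (-ρ) = K := by
    rw [integral_const_mul, integral_exp_neg_Ioi_zero, mul_one]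
  rw [← h1]
  refine setIntegral_mono_on h0 (integrableOn_awDistAt f g) measurableSet_Ioi fun ρ hρ => ?_
  refine mul_le_mul_of_nonneg_right (le_awDistAt f g ?_) (Real.exp_pos _).le
  simpa using le_of_lt hρ

/-- The aw-distance is controlled by the `R`-aw-distance up to a remainder of order `1 / R`. -/
theorem awDist_le_awDistAt_add {f g : UscFcn S A} {K R : ℝ} (hR : 0 < R)
    (hK : |A.distTo A.center f.hypo - A.distTo A.center g.hypo| ≤ K) :
    awDist f g ≤ awDistAt R f g +
      R⁻¹ * ∫ ρ in Set.Ioi (0 : ℝ), (K * (Real.exp (-ρ) * ρ) + 2 * (Real.exp (-ρ) * ρ ^ 2)) := by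
  have h0 : IntegrableOn (fun ρ : ℝ => Real.exp (-ρ)) (Set.Ioi 0) :=
    integrableOn_exp_neg_Ioi 0
  have h1 : IntegrableOn (fun ρ : ℝ => Real.exp (-ρ) * ρ) (Set.Ioi 0) := by
    refine (Real.GammaIntegral_convergent (s := 2) (by norm_num)).congr_fun (fun x _ => ?_)
      measurableSet_Ioi
    norm_num
  have h2 : IntegrableOn (fun ρ : ℝ => Real.exp (-ρ) * ρ ^ 2) (Set.Ioi 0) := by
    refine (Real.GammaIntegral_convergent (s := 3) (by norm_num)).congr_fun (fun x _ => ?_)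
      measurableSet_Ioi
    norm_num
  have hK0 : 0 ≤ K := (abs_nonneg _).trans hK
  have h3 : IntegrableOn (fun ρ : ℝ => K * (Real.exp (-ρ) * ρ) + 2 * (Real.exp (-ρ) * ρ ^ 2))
      (Set.Ioi 0) := (h1.const_mul K).add (h2.const_mul 2)
  have h4 : awDistAt R f g = ∫ ρ in Set.Ioi (0 : ℝ), awDistAt R f g * Real.exp (-ρ) := by
    rw [integral_const_mul, integral_exp_neg_Ioi_zero, mul_one]
  rw [h4, ← integral_const_mul, ← integral_add (h0.const_mul _) (h3.const_mul _)]
  refine setIntegral_mono_on (integrableOn_awDistAt f g)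
    ((h0.const_mul _).add (h3.const_mul _)) measurableSet_Ioi fun ρ hρ => ?_
  have hρ : 0 < ρ := hρ
  have hexp := (Real.exp_pos (-ρ)).le
  -- For `ρ ≤ R` use monotonicity in the radius; for `ρ ≥ R` the crude bound `K + 2ρ` may be
  -- multiplied by `ρ / R ≥ 1`.
  have key : awDistAt ρ f g ≤ awDistAt R f g + R⁻¹ * ((K + 2 * ρ) * ρ) := by
    rcases le_total ρ R with h | h
    · have := awDistAt_mono f g h
      have : 0 ≤ R⁻¹ * ((K + 2 * ρ) * ρ) := by positivity
      simp only at *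
      linarith
    · have h5 := awDistAt_le hρ.le f g
      have h6 := awDistAt_nonneg R f g
      have h7 : K + 2 * ρ ≤ R⁻¹ * ((K + 2 * ρ) * ρ) := by
        rw [inv_mul_eq_div, le_div_iff₀ hR]
        exact mul_le_mul_of_nonneg_left h (by positivity)
      linarith
  calc awDistAt ρ f g * Real.exp (-ρ)
      ≤ (awDistAt R f g + R⁻¹ * ((K + 2 * ρ) * ρ)) * Real.exp (-ρ) :=
        mul_le_mul_of_nonneg_right key hexp
    _ = _ := by ring

/-- Pointwise convergence of the distance functions implies uniform convergence on balls. -/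
theorem eventually_awDistAt_le {l : Filter (UscFcn S A)} {g : UscFcn S A}
    (h : ∀ z, Tendsto (fun f : UscFcn S A => A.distTo z f.hypo) l (𝓝 (A.distTo z g.hypo)))
    (R : ℝ) {η : ℝ} (hη : 0 < η) : ∀ᶠ f in l, awDistAt R f g ≤ η := by
  -- Both distance functions are 1-Lipschitz, so an error `η / 2` on a finite `η / 4`-net grows to
  -- at most `η` on the ball.
  obtain ⟨t, -, ht⟩ := (A.isCompact_closedBall A.center R).elim_nhds_subcover
    (fun x => {z | A.norm (z - x) < η / 4}) fun x _ => by
      refine IsOpen.mem_nhds (isOpen_lt (A.continuous_norm.comp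
        (continuous_id.sub continuous_const)) continuous_const) ?_
      simpa using hη
  have hev : ∀ᶠ f in l, ∀ x ∈ t, |A.distTo x f.hypo - A.distTo x g.hypo| < η / 2 := by
    rw [eventually_all_finset]
    intro x _
    have := (h x).eventually (Metric.ball_mem_nhds _ (half_pos hη))
    filter_upwards [this] with f hf
    simpa [Real.dist_eq] using hf
  filter_upwards [hev] with f hf
  refine Real.iSup_le (fun z => ?_) hη.le
  obtain ⟨x, hx, hzx⟩ := Set.mem_iUnion₂.1 (ht z.2)
  have h1 := abs_diff_le f g z x
  have h2 := hf x hx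
  have h3 : A.norm (z.1 - x) < η / 4 := hzx
  linarith

/-- Pointwise convergence of the distance functions implies aw-convergence. -/
theorem le_nhds_of_tendsto_distTo {l : Filter (UscFcn S A)} {g : UscFcn S A}
    (h : ∀ z, Tendsto (fun f : UscFcn S A => A.distTo z f.hypo) l (𝓝 (A.distTo z g.hypo))) :
    l ≤ 𝓝 g := by
  rw [← tendsto_id', Metric.tendsto_nhds]
  intro e he
  set M := ∫ ρ in Set.Ioi (0 : ℝ),
    ((1 : ℝ) * (Real.exp (-ρ) * ρ) + 2 * (Real.exp (-ρ) * ρ ^ 2)) with hM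
  obtain ⟨R, hR0, hR⟩ : ∃ R : ℝ, 0 < R ∧ R⁻¹ * M < e / 2 := by
    refine ⟨2 * (|M| + 1) / e, by positivity, ?_⟩
    rw [inv_mul_eq_div, div_lt_iff₀ (by positivity)]
    have := le_abs_self M
    have h1 : e / 2 * (2 * (|M| + 1) / e) = |M| + 1 := by field_simp
    linarith
  have h1 : ∀ᶠ f in l, |A.distTo A.center f.hypo - A.distTo A.center g.hypo| ≤ 1 := by
    filter_upwards [(h A.center).eventually (Metric.ball_mem_nhds _ one_pos)] with f hf
    have : |A.distTo A.center f.hypo - A.distTo A.center g.hypo| < 1 := by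
      simpa [Real.dist_eq] using hf
    exact this.le
  filter_upwards [h1, eventually_awDistAt_le h R (half_pos he)] with f hf1 hf2
  have := awDist_le_awDistAt_add hR0 hf1
  rw [← hM] at this
  change awDist f g < e
  linarith

theorem hypo_of_le {f : UscFcn S A} {x : EuclideanSpace ℝ (Fin d)} {a b : ℝ}
    (h : (x, a) ∈ f.hypo) (hb : b ≤ a) : (x, b) ∈ f.hypo := by
  obtain ⟨hx, h⟩ := h
  exact ⟨hx, le_trans (EReal.coe_le_coe_iff.2 hb) h⟩

/-- Translating a hypograph downwards keeps it inside itself, so every competitor for the higher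
point yields one for the lower point at the same distance. -/
theorem distTo_hypo_mono (f : UscFcn S A) (x : EuclideanSpace ℝ (Fin d)) {a b : ℝ} (hb : b ≤ a) :
    A.distTo (x, b) f.hypo ≤ A.distTo (x, a) f.hypo := by
  have : Nonempty f.hypo := f.hypo_nonempty.to_subtype
  refine le_ciInf fun w => ?_
  have hw : ((w : EuclideanSpace ℝ (Fin d) × ℝ).1, w.1.2 - (a - b)) ∈ f.hypo :=
    hypo_of_le w.2 (by linarith)
  refine (ciInf_le (A.bddBelow_distTo (x, b) f.hypo) ⟨_, hw⟩).trans (le_of_eq ?_)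
  congr 1
  ext
  · simp
  · simp only [Prod.snd_sub]
    ring

/-- A nonempty closed subset of `S × ℝ` that is closed under lowering the second coordinate is a
hypograph. -/
theorem exists_hypo_eq {C : Set (EuclideanSpace ℝ (Fin d) × ℝ)} (hC : IsClosed C)
    (hne : C.Nonempty) (hCS : ∀ z ∈ C, z.1 ∈ S)
    (hdown : ∀ x a b, (x, a) ∈ C → b ≤ a → (x, b) ∈ C) : ∃ f : UscFcn S A, f.hypo = C := by
  let φ : S → EReal := fun x => ⨆ a ∈ {a : ℝ | (x.1, a) ∈ C}, (a : EReal)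
  have hlt : ∀ (x : S) (r : ℝ), (x.1, r) ∉ C → φ x ≤ r := by
    intro x r hr
    refine iSup₂_le fun a ha => EReal.coe_le_coe_iff.2 ?_
    by_contra hlt
    exact hr (hdown _ _ _ ha (le_of_lt (not_le.1 hlt)))
  have hle : ∀ (x : S) (r : ℝ), (x.1, r) ∈ C → (r : EReal) ≤ φ x := fun x r hr =>
    le_iSup₂_of_le (f := fun (a : ℝ) (_ : a ∈ {a : ℝ | (x.1, a) ∈ C}) => (a : EReal))
      r hr le_rfl
  have husc : UpperSemicontinuous φ := by
    intro x y hy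
    obtain ⟨r, hr1, hr2⟩ := EReal.lt_iff_exists_real_btwn.1 hy
    have hr : (x.1, r) ∉ C := fun h => absurd hr1 (not_lt.2 (hle x r h))
    have hcont : Continuous fun x' : S => (x'.1, r) := by fun_prop
    filter_upwards [hcont.continuousAt.eventually (hC.isOpen_compl.mem_nhds hr)] with x' hx'
    exact (hlt x' r hx').trans_lt hr2
  obtain ⟨z, hz⟩ := hne
  refine ⟨⟨φ, husc, ⟨z.1, hCS z hz⟩, ?_⟩, ?_⟩
  · exact ((EReal.bot_lt_coe z.2).trans_le (hle ⟨z.1, hCS z hz⟩ z.2 hz)).ne'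
  · ext w
    constructor
    · rintro ⟨hw, h⟩
      -- The supremum need not be known to be attained: heights strictly below `w.2` lie in the
      -- fibre, and closedness of `C` adds `w.2` itself.
      have hmem : ∀ b < w.2, (w.1, b) ∈ C := by
        intro b hb
        by_contra hnot
        exact absurd (h.trans (hlt ⟨w.1, hw⟩ b hnot)) (not_le.2 (EReal.coe_lt_coe_iff.2 hb))
      have ht : Tendsto (fun b : ℝ => (w.1, b)) (𝓝[<] w.2) (𝓝 w) :=
        ((Continuous.prodMk continuous_const continuous_id).tendsto w.2).mono_left
          nhdsWithin_le_nhds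
      exact hC.mem_of_tendsto ht (eventually_nhdsWithin_of_forall hmem)
    · intro hw
      exact ⟨hCS w hw, hle ⟨w.1, hCS w hw⟩ w.2 hw⟩

/-- Bounded ultrafilters converge for the aw-distance. -/
theorem exists_le_nhds_of_ultrafilter (hS : IsClosed S) (U : Ultrafilter (UscFcn S A))
    {f₀ : UscFcn S A} {R : ℝ} (hU : Metric.closedBall f₀ R ∈ U) :
    ∃ g, (U : Filter (UscFcn S A)) ≤ 𝓝 g := by
  have hbdd : ∀ z, ∀ᶠ f in (U : Filter (UscFcn S A)), A.distTo z f.hypo ∈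
      Set.Icc 0 (A.distTo A.center f₀.hypo + R + A.norm (z - A.center)) := by
    intro z
    filter_upwards [hU] with f hf
    have h1 := (abs_distTo_center_le_awDist f f₀).trans (Metric.mem_closedBall.1 hf)
    have h2 := (abs_le.1 h1).2
    have h3 := A.distTo_le_add z A.center f.hypo_nonempty
    exact ⟨Real.iInf_nonneg fun _ => apply_nonneg _ _, by linarith⟩
  have hlim : ∀ z, ∃ D : ℝ, Tendsto (fun f : UscFcn S A => A.distTo z f.hypo) U (𝓝 D) := by
    intro z
    obtain ⟨D, -, hD⟩ := isCompact_Icc.ultrafilter_le_nhds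
      (U.map fun f : UscFcn S A => A.distTo z f.hypo) (le_principal_iff.2 (hbdd z))
    exact ⟨D, hD⟩
  choose D hD using hlim
  have hLip : ∀ z w, D z ≤ D w + A.norm (z - w) := fun z w =>
    le_of_tendsto_of_tendsto' (hD z) ((hD w).add_const _) fun f =>
      A.distTo_le_add z w f.hypo_nonempty
  have hD0 : ∀ z, 0 ≤ D z := fun z => ge_of_tendsto (hD z) ((hbdd z).mono fun _ h => h.1)
  have hDcont : Continuous D := by
    rw [continuous_iff_continuousAt]
    intro z
    rw [ContinuousAt, tendsto_iff_dist_tendsto_zero]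
    have hn : Tendsto (fun w => A.norm (w - z)) (𝓝 z) (𝓝 0) := by
      have := (A.continuous_norm.comp (continuous_id.sub (continuous_const (y := z)))).tendsto z
      simpa [Function.comp_def] using this
    refine squeeze_zero (fun _ => dist_nonneg) (fun w => ?_) hn
    rw [Real.dist_eq, abs_le]
    have h1 := hLip w z
    have h2 := hLip z w
    rw [map_sub_rev] at h2
    constructor <;> linarith
  -- The zero set of the limit `D` is the candidate hypograph; what remains is that `D` is the
  -- distance function to it.
  set C : Set (EuclideanSpace ℝ (Fin d) × ℝ) := {z | D z ≤ 0} with hCdef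
  have hC : IsClosed C := isClosed_le hDcont continuous_const
  -- Near-projections of `z` onto the hypographs stay in a compact ball, and their ultrafilter limit
  -- belongs to `C`. In particular `C` is nonempty: no mass escapes to infinity.
  have hproj : ∀ z, ∀ η > 0, ∃ a ∈ C, A.norm (z - a) ≤ D z + η := by
    intro z η hη
    have hnear : ∀ f : UscFcn S A, ∃ a ∈ f.hypo, A.norm (z - a) < A.distTo z f.hypo + η / 2 := by
      intro f
      have : Nonempty f.hypo := f.hypo_nonempty.to_subtype
      obtain ⟨a, ha⟩ := exists_lt_of_ciInf_lt
        (show A.distTo z f.hypo < A.distTo z f.hypo + η / 2 by linarith)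
      exact ⟨a, a.2, ha⟩
    choose a ha hza using hnear
    have hev : ∀ᶠ f in (U : Filter (UscFcn S A)), a f ∈ {w | A.norm (w - z) ≤ D z + η} := by
      filter_upwards [(hD z).eventually (gt_mem_nhds (show D z < D z + η / 2 by linarith))]
        with f hf
      have := hza f
      rw [map_sub_rev] at this
      change A.norm (a f - z) ≤ D z + η
      linarith
    obtain ⟨b, hb, hlimb⟩ := (A.isCompact_closedBall z (D z + η)).ultrafilter_le_nhds
      (U.map a) (le_principal_iff.2 hev)
    have hlimb : Tendsto a U (𝓝 b) := hlimb
    refine ⟨b, ?_, by rw [map_sub_rev]; exact hb⟩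
    have hn : Tendsto (fun f => A.norm (b - a f)) U (𝓝 0) := by
      have := ((A.continuous_norm.comp
        ((continuous_const (y := b)).sub continuous_id)).tendsto b).comp hlimb
      simpa [Function.comp_def] using this
    refine le_of_tendsto_of_tendsto' (hD b) hn fun f => ?_
    have := A.distTo_le_add b (a f) f.hypo_nonempty
    rwa [A.distTo_eq_zero_of_mem (ha f), zero_add] at this
  have hCS : ∀ z ∈ C, z.1 ∈ S := by
    intro z hz
    have hz0 : D z = 0 := le_antisymm hz (hD0 z)
    -- The distance to `S × ℝ` is at most the distance to each hypograph, whose limit at `z` is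
    -- zero.
    have hcl : z ∈ closure (Prod.fst ⁻¹' S : Set (EuclideanSpace ℝ (Fin d) × ℝ)) := by
      have hne : (Prod.fst ⁻¹' S : Set (EuclideanSpace ℝ (Fin d) × ℝ)).Nonempty :=
        f₀.hypo_nonempty.mono fun w hw => hw.1
      refine A.mem_closure_of_distTo_le hne (ge_of_tendsto' (hz0 ▸ hD z) fun f => ?_)
      have : Nonempty f.hypo := f.hypo_nonempty.to_subtype
      exact le_ciInf fun w => ciInf_le (A.bddBelow_distTo z _) ⟨w.1, w.2.1⟩
    rwa [(hS.preimage continuous_fst).closure_eq] at hcl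
  obtain ⟨g, hg⟩ := exists_hypo_eq (A := A) hC (let ⟨a, ha, _⟩ := hproj A.center 1 one_pos; ⟨a, ha⟩)
    hCS fun x a b h hb => (le_of_tendsto_of_tendsto' (hD _) (hD _) fun f =>
      f.distTo_hypo_mono x hb).trans h
  refine ⟨g, le_nhds_of_tendsto_distTo fun z => ?_⟩
  have hDz : A.distTo z g.hypo = D z := by
    have : Nonempty g.hypo := g.hypo_nonempty.to_subtype
    -- The upper bound comes from `hproj`, the lower bound from the Lipschitz property of `D` and
    -- its vanishing on `C`.
    refine le_antisymm (le_of_forall_pos_le_add fun η hη => ?_) (le_ciInf fun a => ?_)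
    · obtain ⟨a, ha, h⟩ := hproj z η hη
      rw [← hg] at ha
      exact (ciInf_le (A.bddBelow_distTo z _) ⟨a, ha⟩).trans h
    · have ha : D a.1 ≤ 0 := by
        have := hg.le a.2
        exact this
      have := hLip z a
      linarith
  rw [hDz]
  exact hD z

/-- Closed balls in `usc-fcns(S)` are compact when `S` is closed. -/
theorem properSpace (hS : IsClosed S) : ProperSpace (UscFcn S A) := by
  refine ⟨fun f r => isCompact_iff_ultrafilter_le_nhds.2 fun U hU => ?_⟩
  have hU' : Metric.closedBall f r ∈ (U : Filter (UscFcn S A)) := le_principal_iff.1 hU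
  obtain ⟨g, hg⟩ := exists_le_nhds_of_ultrafilter hS U hU'
  exact ⟨g, Metric.isClosed_closedBall.mem_of_tendsto (tendsto_id'.2 hg) hU', hg⟩

end UscFcn

/-! ### Extended-real expectations and the strong law of large numbers -/

theorem extSum_mono {n : ℕ} {a b : ℕ → EReal} (h : ∀ j < n, a j ≤ b j) :
    extSum n a ≤ extSum n b := by
  rw [extSum, extSum]
  split_ifs with ha hb hb
  · exact le_rfl
  · obtain ⟨j, hj, hja⟩ := ha
    exact absurd ⟨j, hj, top_le_iff.1 (hja ▸ h j hj)⟩ hb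
  · exact le_top
  · exact Finset.sum_le_sum fun j hj => h j (Finset.mem_range.1 hj)

theorem extSum_coe (n : ℕ) (a : ℕ → ℝ) :
    extSum n (fun j => (a j : EReal)) = ((∑ j ∈ Finset.range n, a j : ℝ) : EReal) := by
  rw [extSum, if_neg (by simp)]
  induction n with
  | zero => simp
  | succ n ih => rw [Finset.sum_range_succ, Finset.sum_range_succ, ih, EReal.coe_add]

theorem inv_natCast_mul_mono (n : ℕ) {a b : EReal} (h : a ≤ b) :
    (((n : ℝ)⁻¹ : ℝ) : EReal) * a ≤ (((n : ℝ)⁻¹ : ℝ) : EReal) * b :=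
  mul_le_mul_of_nonneg_left h (EReal.coe_nonneg.2 (by positivity))

section Expectation

variable {Ξ : Type*} [MeasurableSpace Ξ] {μ : Measure Ξ}

/-- With a finite negative part the form `∞ - ∞` cannot occur, so the two branches of the definition
agree. -/
theorem extExpectation_eq_sub {h : Ξ → EReal} (hneg : ∫⁻ x, (-(h x)).toENNReal ∂μ ≠ ⊤) :
    extExpectation μ h = ((∫⁻ x, (h x).toENNReal ∂μ : ENNReal) : EReal)
      - ((∫⁻ x, (-(h x)).toENNReal ∂μ : ENNReal) : EReal) := by
  rw [extExpectation]
  split_ifs with htop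
  · rw [htop, EReal.coe_ennreal_top, EReal.top_sub (by simpa using hneg)]
  · rfl

/-- Monotone convergence for extended-real expectations. -/
theorem tendsto_extExpectation_of_monotone {h : ℕ → Ξ → EReal} {g : Ξ → EReal}
    (hm : ∀ n, Measurable (h n)) (hmono : ∀ x, Monotone fun n => h n x)
    (hlim : ∀ x, Tendsto (fun n => h n x) atTop (𝓝 (g x)))
    (hneg : ∫⁻ x, (-(h 0 x)).toENNReal ∂μ ≠ ⊤) :
    Tendsto (fun n => extExpectation μ (h n)) atTop (𝓝 (extExpectation μ g)) := by
  have hneg_le : ∀ n, ∫⁻ x, (-(h n x)).toENNReal ∂μ ≠ ⊤ := fun n =>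
    ne_top_of_le_ne_top hneg (lintegral_mono fun x =>
      EReal.toENNReal_le_toENNReal (EReal.neg_le_neg_iff.2 (hmono x (Nat.zero_le n))))
  have hg : ∫⁻ x, (-(g x)).toENNReal ∂μ ≠ ⊤ :=
    ne_top_of_le_ne_top hneg (lintegral_mono fun x => EReal.toENNReal_le_toENNReal
      (EReal.neg_le_neg_iff.2 ((hmono x).ge_of_tendsto (hlim x) 0)))
  rw [extExpectation_eq_sub hg]
  simp_rw [extExpectation_eq_sub (hneg_le _)]
  have hpos : Tendsto (fun n => ∫⁻ x, (h n x).toENNReal ∂μ) atTop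
      (𝓝 (∫⁻ x, (g x).toENNReal ∂μ)) :=
    lintegral_tendsto_of_tendsto_of_monotone (fun n => (hm n).ereal_toENNReal.aemeasurable)
      (Eventually.of_forall fun x a b hab => EReal.toENNReal_le_toENNReal (hmono x hab))
      (Eventually.of_forall fun x => (EReal.continuous_toENNReal.tendsto _).comp (hlim x))
  have hmin : Tendsto (fun n => ∫⁻ x, (-(h n x)).toENNReal ∂μ) atTop
      (𝓝 (∫⁻ x, (-(g x)).toENNReal ∂μ)) :=
    lintegral_tendsto_of_tendsto_of_antitone
      (fun n => (hm n).neg.ereal_toENNReal.aemeasurable)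
      (Eventually.of_forall fun x a b hab =>
        EReal.toENNReal_le_toENNReal (EReal.neg_le_neg_iff.2 (hmono x hab))) hneg
      (Eventually.of_forall fun x => ((EReal.continuous_toENNReal.comp continuous_neg).tendsto
        _).comp (hlim x))
  have h1 := (continuous_coe_ennreal_ereal.tendsto _).comp hpos
  have h2 := (continuous_neg.tendsto _).comp ((continuous_coe_ennreal_ereal.tendsto _).comp hmin)
  have hadd := EReal.continuousAt_add (p := (((∫⁻ x, (g x).toENNReal ∂μ : ENNReal) : EReal),
    -((∫⁻ x, (-(g x)).toENNReal ∂μ : ENNReal) : EReal))) (Or.inr (by simpa using hg))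
    (Or.inl (EReal.coe_ennreal_ne_bot _))
  exact hadd.tendsto.comp (h1.prodMk_nhds h2)

/-- If both parts are integrable, the extended expectation is the Bochner integral. -/
theorem extExpectation_eq_integral {h : Ξ → EReal} (hm : Measurable h)
    (hpos : ∫⁻ x, (h x).toENNReal ∂μ ≠ ⊤) (hneg : ∫⁻ x, (-(h x)).toENNReal ∂μ ≠ ⊤) :
    (∀ᵐ x ∂μ, ((h x).toReal : EReal) = h x) ∧ Integrable (fun x => (h x).toReal) μ ∧
      extExpectation μ h = ((∫ x, (h x).toReal ∂μ : ℝ) : EReal) := by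
  have h1 : ∀ᵐ x ∂μ, h x ≠ ⊤ := by
    filter_upwards [ae_lt_top hm.ereal_toENNReal hpos] with x hx
    exact EReal.toENNReal_ne_top_iff.1 hx.ne
  have h2 : ∀ᵐ x ∂μ, h x ≠ ⊥ := by
    filter_upwards [ae_lt_top hm.neg.ereal_toENNReal hneg] with x hx
    have := EReal.toENNReal_ne_top_iff.1 hx.ne
    simpa using this
  have hcoe : ∀ᵐ x ∂μ, ((h x).toReal : EReal) = h x := by
    filter_upwards [h1, h2] with x hx1 hx2
    exact EReal.coe_toReal hx1 hx2
  have e1 : ∫⁻ x, ENNReal.ofReal (h x).toReal ∂μ = ∫⁻ x, (h x).toENNReal ∂μ := by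
    refine lintegral_congr_ae ?_
    filter_upwards [h1] with x hx
    rw [EReal.toENNReal_of_ne_top hx]
  have e2 : ∫⁻ x, ENNReal.ofReal (-(h x).toReal) ∂μ = ∫⁻ x, (-(h x)).toENNReal ∂μ := by
    refine lintegral_congr_ae ?_
    filter_upwards [h2] with x hx
    rw [EReal.toENNReal_of_ne_top (by simpa using hx), EReal.toReal_neg_eq]
  have hint : Integrable (fun x => (h x).toReal) μ := by
    refine ⟨hm.ereal_toReal.aestronglyMeasurable, ?_⟩
    rw [hasFiniteIntegral_iff_norm]
    calc ∫⁻ x, ENNReal.ofReal ‖(h x).toReal‖ ∂μ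
        ≤ ∫⁻ x, (ENNReal.ofReal (h x).toReal + ENNReal.ofReal (-(h x).toReal)) ∂μ := by
          refine lintegral_mono fun x => ?_
          rcases le_total 0 (h x).toReal with hx | hx
          · rw [Real.norm_of_nonneg hx]
            exact le_self_add
          · rw [Real.norm_of_nonpos hx]
            exact le_add_self
      _ = ∫⁻ x, (h x).toENNReal ∂μ + ∫⁻ x, (-(h x)).toENNReal ∂μ := by
          rw [lintegral_add_left hm.ereal_toReal.ennreal_ofReal, e1, e2]
      _ < ⊤ := ENNReal.add_lt_top.2 ⟨hpos.lt_top, hneg.lt_top⟩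
  refine ⟨hcoe, hint, ?_⟩
  rw [extExpectation_eq_sub hneg, integral_eq_lintegral_pos_part_sub_lintegral_neg_part hint,
    e1, e2, EReal.coe_sub, EReal.coe_ennreal_toReal hpos, EReal.coe_ennreal_toReal hneg]

end Expectation

namespace IsIIDSample

variable {Ω Ξ : Type*} [MeasurableSpace Ω] [MeasurableSpace Ξ] {X : ℕ → Ω → Ξ} {P : Measure Ω}
  {P₀ : Measure Ξ}

theorem aemeasurable_comp {β : Type*} [MeasurableSpace β] [MeasurableSpace.CountablyGenerated β]
    [Nonempty β] (hX : IsIIDSample X P P₀) {h : Ξ → β} (hh : Measurable h) (j : ℕ) :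
    AEMeasurable (fun ω => h (X j ω)) P :=
  (hh.comp_nullMeasurable (hX.nullMeasurable j)).aemeasurable

theorem map_comp {β : Type*} [MeasurableSpace β] [MeasurableSpace.CountablyGenerated β]
    [Nonempty β] (hX : IsIIDSample X P P₀) {h : Ξ → β} (hh : Measurable h) (j : ℕ) :
    P.map (fun ω => h (X j ω)) = P₀.map h := by
  ext s hs
  rw [Measure.map_apply_of_aemeasurable (hX.aemeasurable_comp hh j) hs, Measure.map_apply hh hs,
    ← hX.law j _ (hh hs)]
  rfl

theorem lintegral_comp (hX : IsIIDSample X P P₀) {h : Ξ → ENNReal} (hh : Measurable h) (j : ℕ) :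
    ∫⁻ ω, h (X j ω) ∂P = ∫⁻ x, h x ∂P₀ := by
  have h1 := lintegral_map' (μ := P) (f := fun y : ENNReal => y) aemeasurable_id
    (hX.aemeasurable_comp hh j)
  have h2 := lintegral_map' (μ := P₀) (f := fun y : ENNReal => y) aemeasurable_id
    hh.aemeasurable
  rw [← h1, ← h2, hX.map_comp hh j]

theorem ae_comp (hX : IsIIDSample X P P₀) {p : Ξ → Prop} (hp : MeasurableSet {x | p x})
    (h : ∀ᵐ x ∂P₀, p x) : ∀ᵐ ω ∂P, ∀ j, p (X j ω) := by
  rw [ae_all_iff]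
  intro j
  rw [ae_iff] at h ⊢
  rw [← h]
  exact hX.law j _ hp.compl

theorem extExpectation_comp (hX : IsIIDSample X P P₀) {h : Ξ → EReal} (hh : Measurable h)
    (j : ℕ) : extExpectation P (fun ω => h (X j ω)) = extExpectation P₀ h := by
  have hneg : Measurable fun x => (-(h x)).toENNReal := hh.neg.ereal_toENNReal
  rw [extExpectation, extExpectation, hX.lintegral_comp hh.ereal_toENNReal j,
    hX.lintegral_comp hneg j]

/-- Strong law of large numbers for integrable extended-real functions. -/
theorem tendsto_average_of_integrable [IsProbabilityMeasure P₀] (hX : IsIIDSample X P P₀)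
    {h : Ξ → EReal} (hm : Measurable h)
    (hpos : ∫⁻ x, (h x).toENNReal ∂P₀ ≠ ⊤) (hneg : ∫⁻ x, (-(h x)).toENNReal ∂P₀ ≠ ⊤) :
    ∀ᵐ ω ∂P, Tendsto (fun n : ℕ => (((n : ℝ)⁻¹ : ℝ) : EReal) * extSum n fun j => h (X j ω))
      atTop (𝓝 (extExpectation P₀ h)) := by
  obtain ⟨hcoe, hint, hE⟩ := extExpectation_eq_integral hm hpos hneg
  have hmr : Measurable fun x => (h x).toReal := hm.ereal_toReal
  have hmap := fun j => hX.map_comp hmr j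
  have hident : ∀ j, IdentDistrib (fun ω => (h (X j ω)).toReal) (fun ω => (h (X 0 ω)).toReal)
      P P := fun j =>
    ⟨hX.aemeasurable_comp hmr j, hX.aemeasurable_comp hmr 0, (hmap j).trans (hmap 0).symm⟩
  have hident₀ : IdentDistrib (fun ω => (h (X 0 ω)).toReal) (fun x => (h x).toReal) P P₀ :=
    ⟨hX.aemeasurable_comp hmr 0, hmr.aemeasurable, hmap 0⟩
  have hindep := hX.indep.comp (fun _ x => (h x).toReal) fun _ => hmr
  have hlaw := strong_law_ae_real (fun j ω => (h (X j ω)).toReal) (hident₀.integrable_iff.2 hint)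
    (fun i j hij => hindep.indepFun hij) hident
  have hcoe' := hX.ae_comp (measurableSet_eq_fun hmr.coe_real_ereal hm) hcoe
  filter_upwards [hlaw, hcoe'] with ω hω hc
  rw [hE, ← hident₀.integral_eq]
  refine ((continuous_coe_real_ereal.tendsto _).comp hω).congr fun n => ?_
  have : (fun j => h (X j ω)) = fun j => ((h (X j ω)).toReal : EReal) := funext fun j => (hc j).symm
  rw [this, extSum_coe, ← EReal.coe_mul, Function.comp_apply, inv_mul_eq_div]

/-- Strong law of large numbers for extended-real functions with integrable negative part. -/
theorem tendsto_average [IsProbabilityMeasure P₀] (hX : IsIIDSample X P P₀)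
    {h : Ξ → EReal} (hm : Measurable h) (hneg : ∫⁻ x, (-(h x)).toENNReal ∂P₀ ≠ ⊤) :
    ∀ᵐ ω ∂P, Tendsto (fun n : ℕ => (((n : ℝ)⁻¹ : ℝ) : EReal) * extSum n fun j => h (X j ω))
      atTop (𝓝 (extExpectation P₀ h)) := by
  by_cases hpos : ∫⁻ x, (h x).toENNReal ∂P₀ = ⊤
  swap
  · exact hX.tendsto_average_of_integrable hm hpos hneg
  set t : ℕ → Ξ → EReal := fun k x => min (h x) ((k : ℝ) : EReal) with ht
  have htm : ∀ k, Measurable (t k) := fun k => hm.min measurable_const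
  have htpos : ∀ k, ∫⁻ x, (t k x).toENNReal ∂P₀ ≠ ⊤ := fun k => by
    refine ne_top_of_le_ne_top (b := ∫⁻ _, ENNReal.ofReal k ∂P₀) (by simp)
      (lintegral_mono fun x => ?_)
    exact (EReal.toENNReal_le_toENNReal (min_le_right _ _)).trans_eq (EReal.real_coe_toENNReal _)
  have htneg : ∀ k, ∫⁻ x, (-(t k x)).toENNReal ∂P₀ ≠ ⊤ := fun k => by
    refine ne_top_of_le_ne_top hneg (lintegral_mono fun x => ?_)
    rcases le_total (h x) ((k : ℝ) : EReal) with hx | hx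
    · simp only [ht, min_eq_left hx]
      exact le_rfl
    · have : -((k : ℝ) : EReal) ≤ 0 := by
        rw [EReal.neg_le_zero]
        exact EReal.coe_nonneg.2 (Nat.cast_nonneg k)
      simp only [ht, min_eq_right hx]
      rw [EReal.toENNReal_of_nonpos this]
      exact zero_le
  have htmono : ∀ x, Monotone fun k => t k x := fun x a b hab =>
    min_le_min le_rfl (EReal.coe_le_coe_iff.2 (Nat.cast_le.2 hab))
  have htlim : ∀ x, Tendsto (fun k => t k x) atTop (𝓝 (h x)) := fun x => by
    have h1 : Tendsto (fun k : ℕ => ((k : ℝ) : EReal)) atTop (𝓝 ⊤) :=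
      EReal.tendsto_coe_atTop.comp tendsto_natCast_atTop_atTop
    have := (tendsto_const_nhds (x := h x)).min h1
    rwa [min_eq_left le_top] at this
  have hE := tendsto_extExpectation_of_monotone (μ := P₀) htm htmono htlim (htneg 0)
  have htop : extExpectation P₀ h = ⊤ := by rw [extExpectation, if_pos hpos]
  have hall := ae_all_iff.2 fun k => hX.tendsto_average_of_integrable (htm k) (htpos k) (htneg k)
  filter_upwards [hall] with ω hω
  rw [htop] at hE ⊢
  rw [EReal.tendsto_nhds_top_iff_real]
  intro c
  obtain ⟨k, hk⟩ := (hE.eventually (lt_mem_nhds (EReal.coe_lt_top c))).exists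
  filter_upwards [(hω k).eventually (lt_mem_nhds hk)] with n hn
  exact hn.trans_le (inv_natCast_mul_mono n (extSum_mono fun j _ => min_le_left _ _))

end IsIIDSample

/-! ### Lower bounds for empirical losses, uniform on neighbourhoods -/

theorem extExpectation_mono {Ξ : Type*} [MeasurableSpace Ξ] {μ : Measure Ξ} {h g : Ξ → EReal}
    (hneg : ∫⁻ x, (-(h x)).toENNReal ∂μ ≠ ⊤) (hle : ∀ x, h x ≤ g x) :
    extExpectation μ h ≤ extExpectation μ g := by
  have hmin : ∫⁻ x, (-(g x)).toENNReal ∂μ ≤ ∫⁻ x, (-(h x)).toENNReal ∂μ := lintegral_mono fun x =>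
    EReal.toENNReal_le_toENNReal (EReal.neg_le_neg_iff.2 (hle x))
  rw [extExpectation_eq_sub hneg, extExpectation_eq_sub (ne_top_of_le_ne_top hneg hmin)]
  exact EReal.sub_le_sub (EReal.coe_ennreal_le_coe_ennreal_iff.2 (lintegral_mono fun x =>
    EReal.toENNReal_le_toENNReal (hle x))) (EReal.coe_ennreal_le_coe_ennreal_iff.2 hmin)

/-- Infima of jointly measurable functions over measurable sets are measurable. -/
theorem measurable_biInf_of_isComplete {Ξ Y : Type*} [MeasurableSpace Ξ]
    (μ : Measure Ξ) [IsFiniteMeasure μ] [μ.IsComplete]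
    [TopologicalSpace Y] [PolishSpace Y] [MeasurableSpace Y] [BorelSpace Y] {ψ : Ξ → Y → EReal}
    (hψ : Measurable fun p : Ξ × Y => ψ p.1 p.2) {U : Set Y} (hU : MeasurableSet U) :
    Measurable fun x => ⨅ g ∈ U, ψ x g := by
  refine measurable_of_Iio fun c => ?_
  have : (fun x => ⨅ g ∈ U, ψ x g) ⁻¹' Set.Iio c
      = Prod.fst '' ({p : Ξ × Y | p.2 ∈ U} ∩ {p : Ξ × Y | ψ p.1 p.2 < c}) := by
    ext x
    simp only [Set.mem_preimage, Set.mem_Iio, iInf_lt_iff]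
    constructor
    · rintro ⟨g, hg, h⟩
      exact ⟨(x, g), ⟨hg, h⟩, rfl⟩
    · rintro ⟨⟨x, g⟩, ⟨hg, h⟩, rfl⟩
      exact ⟨g, hg, h⟩
  rw [this]
  exact ((measurable_snd hU).inter (hψ measurableSet_Iio)).image_fst_of_isComplete μ

theorem LocallyInfIntegrable.lintegral_neg_ne_top {Ξ Y : Type*} [MeasurableSpace Ξ]
    {P₀ : Measure Ξ} [PseudoMetricSpace Y] {ψ : Ξ → Y → EReal} (hψint : LocallyInfIntegrable P₀ ψ) (f : Y) :
    ∫⁻ x, (-(ψ x f)).toENNReal ∂P₀ ≠ ⊤ := by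
  obtain ⟨ρ, hρ, h⟩ := hψint f
  refine ne_top_of_le_ne_top h.ne (lintegral_mono fun x => EReal.toENNReal_le_toENNReal
    (EReal.neg_le_neg_iff.2 (iInf₂_le f ?_)))
  simpa using hρ.le

section LowerBound

variable {Ξ Y : Type*} [MeasurableSpace Ξ] {P₀ : Measure Ξ} [IsProbabilityMeasure P₀]
  [P₀.IsComplete] [MetricSpace Y] [PolishSpace Y] [MeasurableSpace Y] [BorelSpace Y]
  {ψ : Ξ → Y → EReal}

/-- The expectation of the infimum over small neighbourhoods approximates the expectation. -/
theorem exists_mem_countableBasis_lt_extExpectation (hψ : IsRandomLsc ψ)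
    (hψint : LocallyInfIntegrable P₀ ψ) (f : Y) {c : EReal}
    (hc : c < extExpectation P₀ fun x => ψ x f) :
    ∃ U ∈ TopologicalSpace.countableBasis Y, f ∈ U ∧
      ∫⁻ x, (-(⨅ g ∈ U, ψ x g)).toENNReal ∂P₀ ≠ ⊤ ∧
      c < extExpectation P₀ fun x => ⨅ g ∈ U, ψ x g := by
  obtain ⟨ρ, hρ, hfin⟩ := hψint f
  let B : ℕ → Set Y := fun n => {g | dist f g ≤ ρ / ((n : ℝ) + 1)}
  have hBpos : ∀ n : ℕ, 0 < ρ / ((n : ℝ) + 1) := fun n => by positivity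
  have hBanti : Antitone B := fun a b hab g hg => by
    refine le_trans (show dist f g ≤ ρ / ((b : ℝ) + 1) from hg) ?_
    gcongr
  have hneg : ∀ n, ∫⁻ x, (-(⨅ g ∈ B n, ψ x g)).toENNReal ∂P₀ ≠ ⊤ := fun n => by
    refine ne_top_of_le_ne_top hfin.ne (lintegral_mono fun x => EReal.toENNReal_le_toENNReal
      (EReal.neg_le_neg_iff.2 (biInf_mono fun g hg => ?_)))
    have := hBanti (Nat.zero_le n) hg
    simpa [B] using this
  have hBmeas : ∀ n, MeasurableSet (B n) := fun n =>
    (isClosed_le (continuous_const.dist continuous_id) continuous_const).measurableSet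
  have hmono : ∀ x, Monotone fun n => ⨅ g ∈ B n, ψ x g := fun x a b hab =>
    biInf_mono fun g hg => hBanti hab hg
  have hself : ∀ n, f ∈ B n := fun n => by simpa [B] using (hBpos n).le
  have hlim : ∀ x, Tendsto (fun n => ⨅ g ∈ B n, ψ x g) atTop (𝓝 (ψ x f)) := by
    intro x
    refine tendsto_order.2 ⟨fun y hy => ?_, fun y hy => Eventually.of_forall fun n =>
      (iInf₂_le f (hself n)).trans_lt hy⟩
    obtain ⟨r, hyr, hr⟩ := exists_between hy
    obtain ⟨η, hη, hball⟩ := Metric.mem_nhds_iff.1 (hψ.lsc x f r hr)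
    have hsmall : Tendsto (fun n : ℕ => ρ / ((n : ℝ) + 1)) atTop (𝓝 0) := by
      have := (tendsto_one_div_add_atTop_nhds_zero_nat (𝕜 := ℝ)).const_mul ρ
      simpa [div_eq_mul_inv] using this
    filter_upwards [hsmall.eventually (gt_mem_nhds hη)] with n hn
    refine hyr.trans_le (le_iInf₂ fun g hg => le_of_lt (hball ?_))
    rw [Metric.mem_ball, dist_comm]
    exact lt_of_le_of_lt hg hn
  have hE := tendsto_extExpectation_of_monotone (μ := P₀)
    (fun n => measurable_biInf_of_isComplete P₀ hψ.measurable (hBmeas n)) hmono hlim (hneg 0)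
  obtain ⟨n, hn⟩ := (hE.eventually (lt_mem_nhds hc)).exists
  have hnhds : B n ∈ 𝓝 f := by
    filter_upwards [Metric.ball_mem_nhds f (hBpos n)] with g hg
    rw [Metric.mem_ball, dist_comm] at hg
    exact hg.le
  obtain ⟨U, hU, hfU, hUB⟩ :=
    (TopologicalSpace.isBasis_countableBasis Y).mem_nhds_iff.1 hnhds
  have hle : ∀ x, (⨅ g ∈ B n, ψ x g) ≤ ⨅ g ∈ U, ψ x g := fun x =>
    biInf_mono fun g hg => hUB hg
  refine ⟨U, hU, hfU, ?_, hn.trans_le (extExpectation_mono (hneg n) hle)⟩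
  exact ne_top_of_le_ne_top (hneg n) (lintegral_mono fun x => EReal.toENNReal_le_toENNReal
    (EReal.neg_le_neg_iff.2 (hle x)))

/-- Almost surely, the empirical averages are locally uniformly bounded below by any number below
the expectation. -/
theorem IsIIDSample.ae_forall_exists_nhds_lt_average {Ω : Type*} [MeasurableSpace Ω]
    {P : Measure Ω} {X : ℕ → Ω → Ξ} (hX : IsIIDSample X P P₀) (hψ : IsRandomLsc ψ)
    (hψint : LocallyInfIntegrable P₀ ψ) :
    ∀ᵐ ω ∂P, ∀ f, ∀ c < extExpectation P₀ fun x => ψ x f, ∃ U ∈ 𝓝 f, ∀ᶠ n : ℕ in atTop,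
      ∀ g ∈ U, c < (((n : ℝ)⁻¹ : ℝ) : EReal) * extSum n fun j => ψ (X j ω) g := by
  have hall : ∀ᵐ ω ∂P, ∀ U ∈ TopologicalSpace.countableBasis Y,
      ∫⁻ x, (-(⨅ g ∈ U, ψ x g)).toENNReal ∂P₀ ≠ ⊤ →
      Tendsto (fun n : ℕ => (((n : ℝ)⁻¹ : ℝ) : EReal) * extSum n fun j => ⨅ g ∈ U, ψ (X j ω) g)
        atTop (𝓝 (extExpectation P₀ fun x => ⨅ g ∈ U, ψ x g)) := by
    rw [ae_ball_iff (TopologicalSpace.countable_countableBasis Y)]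
    intro U hU
    by_cases hfin : ∫⁻ x, (-(⨅ g ∈ U, ψ x g)).toENNReal ∂P₀ = ⊤
    · exact Eventually.of_forall fun _ h => absurd hfin h
    · have hUm : MeasurableSet U :=
        ((TopologicalSpace.isBasis_countableBasis Y).isOpen hU).measurableSet
      filter_upwards [hX.tendsto_average
        (measurable_biInf_of_isComplete P₀ hψ.measurable hUm) hfin] with ω hω _
      exact hω
  filter_upwards [hall] with ω hω f c hc
  obtain ⟨U, hU, hfU, hfin, hcU⟩ := exists_mem_countableBasis_lt_extExpectation hψ hψint f hc
  refine ⟨U, ((TopologicalSpace.isBasis_countableBasis Y).isOpen hU).mem_nhds hfU, ?_⟩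
  filter_upwards [(hω U hU hfin).eventually (lt_mem_nhds hcU)] with n hn g hg
  exact hn.trans_le (inv_natCast_mul_mono n (extSum_mono fun j _ => iInf₂_le g hg))

end LowerBound

/-! ### Enlargements -/

section Enlarge

variable {Y : Type*} [PseudoMetricSpace Y] {δ : ℝ}

theorem mem_enlarge_of_mem {C : Set Y} {f g : Y} (hg : g ∈ C) (h : dist f g ≤ δ) :
    f ∈ enlarge δ C :=
  (iInf₂_le (f := fun (g : Y) (_ : g ∈ C) => ((dist f g : ℝ) : EReal)) g hg).trans
    (EReal.coe_le_coe_iff.2 h)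

theorem exists_dist_lt_of_mem_enlarge {C : Set Y} {f : Y} (h : f ∈ enlarge δ C) {r : ℝ}
    (hr : δ < r) : ∃ g ∈ C, dist f g < r := by
  obtain ⟨g, hg, hlt⟩ := by
    simpa only [iInf_lt_iff, exists_prop] using lt_of_le_of_lt h (EReal.coe_lt_coe_iff.2 hr)
  exact ⟨g, hg, EReal.coe_lt_coe_iff.1 hlt⟩

/-- The outer limit of enlargements lies in the enlargement of the outer limit. -/
theorem outerLimit_enlarge_subset [ProperSpace Y] (C : ℕ → Set Y) :
    outerLimit (fun n => enlarge δ (C n)) ⊆ enlarge δ (outerLimit C) := by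
  rintro f ⟨k, a, hk, ha, hlim⟩
  have hstep : ∀ i : ℕ, ∃ g ∈ C (k i), dist (a i) g < δ + 1 / ((i : ℝ) + 1) := fun i =>
    exists_dist_lt_of_mem_enlarge (ha i) (lt_add_of_pos_right _ Nat.one_div_pos_of_nat)
  choose b hbC hb using hstep
  have hbound : Tendsto (fun i : ℕ => dist f (a i) + (δ + 1 / ((i : ℝ) + 1))) atTop (𝓝 δ) := by
    have h1 := (tendsto_const_nhds (x := f)).dist hlim
    have h2 := (tendsto_one_div_add_atTop_nhds_zero_nat (𝕜 := ℝ)).const_add δ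
    simpa using h1.add h2
  have hfb : ∀ i, dist f (b i) ≤ dist f (a i) + (δ + 1 / ((i : ℝ) + 1)) := fun i =>
    (dist_triangle f (a i) (b i)).trans (add_le_add le_rfl (hb i).le)
  obtain ⟨R, hR⟩ := hbound.bddAbove_range
  obtain ⟨g, -, φ, hφ, hg⟩ := (isCompact_closedBall f R).tendsto_subseq (x := b) fun i => by
    rw [Metric.mem_closedBall, dist_comm]
    exact (hfb i).trans (hR ⟨i, rfl⟩)
  refine mem_enlarge_of_mem (g := g) ⟨k ∘ φ, b ∘ φ, hk.comp hφ, fun i => hbC _, hg⟩ ?_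
  exact le_of_tendsto_of_tendsto' ((tendsto_const_nhds (x := f)).dist hg)
    (hbound.comp hφ.tendsto_atTop) fun i => hfb (φ i)

theorem outerLimit_mono {Z : Type*} [TopologicalSpace Z] {C D : ℕ → Set Z}
    (h : ∀ n, C n ⊆ D n) : outerLimit C ⊆ outerLimit D := by
  rintro f ⟨k, a, hk, ha, hlim⟩
  exact ⟨k, a, hk, fun i => h _ (ha i), hlim⟩

theorem eventually_mem_enlarge_of_mem_innerLimit {C : ℕ → Set Y} {g : Y}
    (hg : g ∈ innerLimit C) (hδ : 0 < δ) : ∀ᶠ n in atTop, g ∈ enlarge δ (C n) := by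
  obtain ⟨a, ha, hlim⟩ := hg
  filter_upwards [ha, Metric.tendsto_nhds.1 hlim δ hδ] with n h1 h2
  rw [dist_comm] at h2
  exact mem_enlarge_of_mem h1 h2.le

theorem enlarge_univ (hδ : 0 ≤ δ) : enlarge δ (Set.univ : Set Y) = Set.univ :=
  Set.eq_univ_of_forall fun f => mem_enlarge_of_mem (Set.mem_univ f) (by simpa using hδ)

end Enlarge

/-! ### Consistency -/

/-- A countable family of points of `L` along which the infimum of `φ` over `L` is approached. -/
theorem exists_countable_biInf_lt {Y : Type*} (L : Set Y) (φ : Y → EReal) :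
    ∃ T ⊆ L, T.Countable ∧ ∀ c, ⨅ g ∈ L, φ g < c → ∃ g ∈ T, φ g < c := by
  rcases L.eq_empty_or_nonempty with rfl | hne
  · exact ⟨∅, le_rfl, Set.countable_empty, fun c hc => absurd hc (by simp)⟩
  obtain ⟨u, -, hu, huL⟩ := exists_seq_tendsto_sInf (hne.image φ) (OrderBot.bddBelow _)
  choose g hgL hgu using huL
  refine ⟨Set.range g, Set.range_subset_iff.2 hgL, Set.countable_range g, fun c hc => ?_⟩
  rw [← sInf_image] at hc
  obtain ⟨n, hn⟩ := (hu.eventually (gt_mem_nhds hc)).exists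
  exact ⟨g n, ⟨n, rfl⟩, (hgu n).trans_lt hn⟩

/-- Consistency of penalized empirical risk minimization over enlarged sieves, in a proper metric
space. -/
theorem IsIIDSample.ae_outerLimit_epsArgmin_subset {Ξ Y Ω : Type*} [MeasurableSpace Ξ]
    {P₀ : Measure Ξ} [IsProbabilityMeasure P₀] [P₀.IsComplete] [MetricSpace Y] [ProperSpace Y]
    [MeasurableSpace Y] [BorelSpace Y] {ψ : Ξ → Y → EReal} [MeasurableSpace Ω]
    {P : Measure Ω} {X : ℕ → Ω → Ξ} (hX : IsIIDSample X P P₀) (hψ : IsRandomLsc ψ)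
    (hψint : LocallyInfIntegrable P₀ ψ) {C : ℕ → Set Y} {L : Set Y} (hL : SetConverges C L)
    {pen : ℕ → Y → NNReal} (hpen : ∀ g, Tendsto (fun n => pen n g) atTop (𝓝 0))
    {δ : ℝ} (hδ : 0 < δ) {ε : ℕ → ℝ} (hε : Tendsto ε atTop (𝓝 0)) :
    ∀ᵐ ω ∂P, outerLimit (fun n =>
        epsArgmin (ε n) (enlarge δ (C n)) (empiricalLoss ψ n (fun j => X j ω) (pen n)))
      ⊆ {f | f ∈ enlarge δ L ∧ (extExpectation P₀ fun x => ψ x f)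
            ≤ ⨅ g ∈ L, extExpectation P₀ fun x => ψ x g} := by
  obtain ⟨T, hTL, hT, hTinf⟩ := exists_countable_biInf_lt L fun g => extExpectation P₀ fun x => ψ x g
  have hupper := (ae_ball_iff hT).2 fun g _ => hX.tendsto_average
    (h := fun x => ψ x g) (hψ.measurable.comp measurable_prodMk_right)
    (hψint.lintegral_neg_ne_top g)
  filter_upwards [hX.ae_forall_exists_nhds_lt_average hψ hψint, hupper] with ω hlow hup f hf
  refine ⟨?_, ?_⟩
  · have := outerLimit_enlarge_subset C (outerLimit_mono (fun n => Set.sep_subset _ _) hf)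
    rwa [hL.1] at this
  by_contra hlt
  obtain ⟨g, hgT, hg⟩ := hTinf _ (not_le.1 hlt)
  obtain ⟨c, hgc, hcf⟩ := EReal.lt_iff_exists_real_btwn.1 hg
  obtain ⟨c', hcc', hcf'⟩ := EReal.lt_iff_exists_real_btwn.1 hcf
  obtain ⟨U, hU, hUev⟩ := hlow f c' hcf'
  obtain ⟨k, a, hk, ha, hlim⟩ := hf
  have hgL : ∀ᶠ n in atTop, g ∈ enlarge δ (C n) :=
    eventually_mem_enlarge_of_mem_innerLimit (hL.2.symm ▸ hTL hgT) hδ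
  have hloss : ∀ᶠ n : ℕ in atTop, (((n : ℝ)⁻¹ : ℝ) : EReal) * extSum n (fun j => ψ (X j ω) g) < c :=
    (hup g hgT).eventually (gt_mem_nhds hgc)
  have hgap : ∀ᶠ n in atTop, c + (pen n g : ℝ) + ε n < c' := by
    have h1 : Tendsto (fun n => c + (pen n g : ℝ) + ε n) atTop (𝓝 (c + 0 + 0)) :=
      ((NNReal.tendsto_coe.2 (hpen g)).const_add c).add hε
    rw [add_zero, add_zero] at h1
    exact h1.eventually (gt_mem_nhds (EReal.coe_lt_coe_iff.1 hcc'))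
  have hev := hk.tendsto_atTop.eventually (((hUev.and hgL).and hloss).and hgap)
  obtain ⟨i, ⟨⟨⟨h1, h2⟩, h3⟩, h4⟩, h5⟩ := (hev.and (hlim.eventually hU)).exists
  have hmin := (ha i).2
  have hlower : (c' : EReal) < empiricalLoss ψ (k i) (fun j => X j ω) (pen (k i)) (a i) :=
    (h1 (a i) h5).trans_le (le_add_of_nonneg_right (EReal.coe_nonneg.2 (NNReal.coe_nonneg _)))
  have hupper' : empiricalLoss ψ (k i) (fun j => X j ω) (pen (k i)) g
      ≤ ((c + (pen (k i) g : ℝ) : ℝ) : EReal) := by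
    rw [EReal.coe_add]
    exact add_le_add h3.le le_rfl
  have hfinal : empiricalLoss ψ (k i) (fun j => X j ω) (pen (k i)) (a i)
      ≤ ((c + (pen (k i) g : ℝ) + ε (k i) : ℝ) : EReal) := by
    rw [EReal.coe_add]
    exact hmin.trans (add_le_add ((iInf₂_le g h2).trans hupper') le_rfl)
  exact absurd (hlower.trans_le hfinal) (not_lt.2 (EReal.coe_le_coe_iff.2 h4.le))

theorem theorem3p7 {d d₀ : ℕ} (S : Set (EuclideanSpace ℝ (Fin d))) (hSne : S.Nonempty)
    (hS : IsClosed S) (A : AWFrame d)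
    (S₀ : Set (EuclideanSpace ℝ (Fin d₀))) [MeasurableSpace S₀]
    (P₀ : Measure S₀) [IsProbabilityMeasure P₀] [P₀.IsComplete]
    {Ω : Type*} [MeasurableSpace Ω] (P : Measure Ω) [IsProbabilityMeasure P]
    (X : ℕ → Ω → S₀) (hX : IsIIDSample X P P₀)
    (F : Set (UscFcn S A)) (hF : IsClosed F) (Fn : ℕ → Set F)
    (L : Set F) (hL : SetConverges Fn L)
    (ψ : S₀ → F → EReal) (hψ : IsRandomLsc ψ) (hψint : LocallyInfIntegrable P₀ ψ)
    (pen : ℕ → F → NNReal)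
    (hpen : ∀ f : ℕ → F, (∃ g, Tendsto f atTop (𝓝 g)) →
      Tendsto (fun n => pen n (f n)) atTop (𝓝 0))
    (δ : ℝ) (hδ : 0 < δ) (ε : ℕ → ℝ) (hε0 : ∀ n, 0 ≤ ε n) (hε : Tendsto ε atTop (𝓝 0)) :
    (∀ᵐ ω ∂P,
      outerLimit (fun n =>
          epsArgmin (ε n) (enlarge δ (Fn n)) (empiricalLoss ψ n (fun j => X j ω) (pen n)))
        ⊆ {f | f ∈ enlarge δ L ∧ extExpectation P (fun ω => ψ (X 0 ω) f)
              ≤ ⨅ g ∈ L, extExpectation P (fun ω => ψ (X 0 ω) g)}) ∧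
    (L = Set.univ →
      {f | f ∈ enlarge δ L ∧ extExpectation P (fun ω => ψ (X 0 ω) f)
              ≤ ⨅ g ∈ L, extExpectation P (fun ω => ψ (X 0 ω) g)}
        = epsArgmin 0 Set.univ (fun f => extExpectation P (fun ω => ψ (X 0 ω) f))) := by

  have := UscFcn.properSpace (A := A) hS
  have : ProperSpace F := LipschitzWith.subtype_val F |>.properSpace hF.isClosedEmbedding_subtypeVal.isProperMap
  have hE : ∀ f : F, extExpectation P (fun ω => ψ (X 0 ω) f)
      = extExpectation P₀ fun x => ψ x f := fun f =>
    hX.extExpectation_comp (h := fun x => ψ x f)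
      (hψ.measurable.comp measurable_prodMk_right) 0
  refine ⟨?_, ?_⟩
  · simp_rw [hE]
    exact hX.ae_outerLimit_epsArgmin_subset hψ hψint hL (fun g => hpen _ ⟨g, tendsto_const_nhds⟩)
      hδ hε
  · rintro rfl
    rw [enlarge_univ hδ.le]
    simp only [epsArgmin, EReal.coe_zero, add_zero]
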